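/- **The KPR algorithm.** The input is a finite graph $G=(V,E)$ and an integer $R\ge 1$. Start with $F=\emptyset$ and perform three phases. In each phase, for every connected component $C$ of $G\setminus F$ (as it is at the beginning of the phase), perform breadth-first search in $C$ from a root $r\in C$, sample $k$ uniformly from $\{0,1,\dots,R-1\}$, independently of all other samples, and add to $F$ every edge of $C$ that joins a vertex at distance $\ell$ from $r$ in $C$ to a vertex at distance $\ell+1$ from $r$ in $C$ for some $\ell\equiv k \pmod R$. The clusters are the connected components of $G\setminus F$ after the third phase; $u,v$ are *separated* if they lie in different clusters. The roots are chosen adversarially, by a *root rule* $\mathrm{root}$, which assigns to each nonempty $S\subseteq V$ an element $\mathrm{root}(S)\in S$: the root of a component with vertex set $S$ is $\mathrm{root}(S)$. Let $d(u,v)$ be the shortest-path distance (number of edges) in $G$. **Theorem.** (1) For all natural numbers $n$ and $d$ with $1\le d\le \sqrt n/3$ there are a planar graph $G$ on $n$ vertices, vertices $u,v$ of $G$ with $d(u,v)=d$, and a root rule such that for every integer $R>2d$ the KPR algorithm with parameter $R$ and this root rule separates $u$ and $v$ with probability $0$. (2) Consequently the KPR algorithm has no nontrivial lower bound on the separation probability: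 if $g:\mathbb R\to\mathbb R$ is such that for every finite planar graph, every integer $R\ge1$, every root rule and every pair $u,v$ of vertices in the same connected component of the graph, KPR separates $u$ and $v$ with probability at least $g(d(u,v)/R)$, then $g(d/R)\le 0$ for all integers $d\ge 1$ and $R>2d$. -/

import Mathlib

/-- A graph is planar if it can be drawn in the plane without crossings: vertices are distinct
points, each edge `ab` is a simple arc joining the points of `a` and `b`, an arc contains no vertex
other than its two ends, and two different arcs meet only at the points of common ends. -/
def SimpleGraph.IsPlanar {V : Type*} (G : SimpleGraph V) : Prop :=
  ∃ (pt : V → ℝ × ℝ) (arc : Sym2 V → Set (ℝ × ℝ)),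
    Function.Injective pt ∧
    (∀ a b, G.Adj a b →
      ∃ γ : _root_.Path (pt a) (pt b), Function.Injective γ ∧ Set.range γ = arc s(a, b)) ∧
    (∀ e ∈ G.edgeSet, ∀ w, pt w ∈ arc e → w ∈ e) ∧
    (∀ e ∈ G.edgeSet, ∀ f ∈ G.edgeSet, e ≠ f →
      arc e ∩ arc f ⊆ pt '' {w | w ∈ e ∧ w ∈ f})

/-- A rule for choosing BFS roots: every nonempty vertex set `S` (the vertex set of a component)
is given a root `root S` lying in `S`. -/
def IsRootRule {V : Type*} (root : Set V → V) : Prop :=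
  ∀ S : Set V, S.Nonempty → root S ∈ S

/-- The edges cut in one phase, on the current graph `H`. In each component `C`, BFS is run from
`root C`; an edge `xy` of `C` is at level `ℓ` if `x` has BFS level `ℓ` and `y` has BFS level
`ℓ + 1` (or vice versa); it is cut if `ℓ ≡ k C` modulo `R`. -/
def kprCut {V : Type*} (H : SimpleGraph V) (R : ℕ) (root : Set V → V)
    (k : H.ConnectedComponent → Fin R) : Set (Sym2 V) :=
  {e | ∃ (x y : V) (ℓ : ℕ), e = s(x, y) ∧ H.Adj x y ∧
    H.dist (root (H.connectedComponentMk x).supp) x = ℓ ∧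
    H.dist (root (H.connectedComponentMk x).supp) y = ℓ + 1 ∧
    ℓ ≡ (k (H.connectedComponentMk x) : ℕ) [MOD R]}

open Classical in
/-- One phase: an offset in `{0, …, R - 1}` is sampled independently and uniformly for each
component of `G \ F`, and the edges cut are added to `F`. -/
noncomputable def kprPhase {V : Type*} [Finite V] (G : SimpleGraph V) (R : ℕ) [NeZero R]
    (root : Set V → V) (F : Set (Sym2 V)) : PMF (Set (Sym2 V)) :=
  letI : Fintype (G.deleteEdges F).ConnectedComponent := Fintype.ofFinite _
  (PMF.uniformOfFintype ((G.deleteEdges F).ConnectedComponent → Fin R)).map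
    fun k => F ∪ kprCut (G.deleteEdges F) R root k

/-- The law of the set `F` of removed edges after `m` phases, starting from `F = ∅`. -/
noncomputable def kprPhases {V : Type*} [Finite V] (G : SimpleGraph V) (R : ℕ) [NeZero R]
    (root : Set V → V) : ℕ → PMF (Set (Sym2 V))
  | 0 => PMF.pure ∅
  | m + 1 => (kprPhases G R root m).bind (kprPhase G R root)

/-- The law of the set `F` of edges removed by the KPR algorithm (three phases); the clusters are
the connected components of `G \ F`. -/
noncomputable def kpr {V : Type*} [Finite V] (G : SimpleGraph V) (R : ℕ) [NeZero R]
    (root : Set V → V) : PMF (Set (Sym2 V)) :=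
  kprPhases G R root 3

/-- The probability that the KPR algorithm puts `u` and `v` into different clusters. -/
noncomputable def kprSepProb {V : Type*} [Finite V] (G : SimpleGraph V) (R : ℕ) [NeZero R]
    (root : Set V → V) (u v : V) : ENNReal :=
  (kpr G R root).toOuterMeasure {F | ¬ (G.deleteEdges F).Reachable u v}

/-- `g` is a lower bound on the separation probability of the KPR algorithm, as a function of
`ρ = d(u, v) / R`: the bound holds for all finite planar graphs, all parameters `R ≥ 1`, all root
rules and all pairs of vertices at finite distance. -/
def IsKPRLowerBound (g : ℝ → ℝ) : Prop :=
  ∀ (n : ℕ) (G : SimpleGraph (Fin n)) (R : ℕ) [NeZero R] (root : Set (Fin n) → Fin n)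
    (u v : Fin n), G.IsPlanar → IsRootRule root → G.Reachable u v →
    g ((G.dist u v : ℝ) / (R : ℝ)) ≤ (kprSepProb G R root u v).toReal

/-! The witness is a globe: `3 * d` meridians of length `2 * d` joining two poles, and an equator
that is a cycle of length `3 * d`. The vertices `u` and `v` lie on the equator and split it into a
short arc of length `d` and a long arc of length `2 * d`. The adversary wastes the three phases one
after another, for every outcome of the sampling.

Seen from a pole, all of the equator has level `d`, so no equator edge is cut. No level on the globe
exceeds `2 * d < R`, so at most one level is cut there, and a first phase rooted at a pole leaves
one of the hemispheres intact (`containsNorth_or_of_root_pole`). Rooting the second phase at the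
pole of that hemisphere again spares the equator (`containsEquator_of_root_pole`). In the third
phase, unless a hemisphere is still intact, the root is the midpoint of the long arc: edges of the
long arc have lower levels below `d`, edges of the short arc have lower levels at least `d` and
below `2 * d`. One cut level cannot hit both arcs (`reachable_of_root_equator`), so `u` and `v` stay
connected. The root rule looks only at which vertices survive, hence does not depend on `R`.

Two facts support this. Clusters are always induced subgraphs, so surviving vertices bring all their
mutual edges with them. Levels in a damaged graph are bounded below by 1-Lipschitz functions on the
undamaged globe, and above by explicit chains. The rest is a planar drawing of the globe and a
vertex count. -/

/-! ### Levels, cuts and induced components in a general graph. -/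

/-- Components of `G \ F` are induced subgraphs of `G`: a removed edge joins two components. -/
def RemovesBetweenComponents {V : Type*} (G : SimpleGraph V) (F : Set (Sym2 V)) : Prop :=
  ∀ x y, G.Adj x y → (G.deleteEdges F).Reachable x y → s(x, y) ∉ F

theorem reachable_root {V : Type*} {H : SimpleGraph V} {root : Set V → V} (hroot : IsRootRule root)
    (x : V) : H.Reachable (root (H.connectedComponentMk x).supp) x := by
  have h := hroot (H.connectedComponentMk x).supp ⟨x, rfl⟩
  exact SimpleGraph.ConnectedComponent.exact h

theorem SimpleGraph.Reachable.dist_le_succ_of_adj {V : Type*} {H : SimpleGraph V} {r x y : V}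
    (hr : H.Reachable r x) (h : H.Adj x y) : H.dist r y ≤ H.dist r x + 1 := by
  obtain ⟨p, hp⟩ := hr.exists_walk_length_eq_dist
  have := SimpleGraph.dist_le (p.concat h)
  rw [SimpleGraph.Walk.length_concat] at this
  omega

/-- A function that is 1-Lipschitz on `G` stays so on every subgraph, so one function bounds levels
from below in all phases. -/
theorem SimpleGraph.sub_le_dist {V : Type*} {G H : SimpleGraph V} (hle : H ≤ G) {f : V → ℤ}
    (hf : ∀ x y, G.Adj x y → |f x - f y| ≤ 1) {x y : V} (h : H.Reachable x y) :
    f y - f x ≤ H.dist x y := by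
  obtain ⟨p, hp⟩ := h.exists_walk_length_eq_dist
  rw [← hp]
  clear hp h
  induction p with
  | nil => simp
  | cons hadj p ih =>
    have := abs_le.1 (hf _ _ (hle hadj))
    rw [SimpleGraph.Walk.length_cons]
    push_cast
    linarith

/-- Within one component all edges from level `l` to level `l + 1` are cut together, and levels of
adjacent vertices differ by at most one. A walk that starts at level at most `l` therefore never
climbs above `l`. -/
theorem not_reachable_of_mem_kprCut {V : Type*} {H : SimpleGraph V} {R : ℕ} {root : Set V → V}
    (hroot : IsRootRule root) (k : H.ConnectedComponent → Fin R) {x y : V}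
    (hmem : s(x, y) ∈ kprCut H R root k) :
    ¬ (H.deleteEdges (kprCut H R root k)).Reachable x y := by
  intro hreach
  obtain ⟨x', y', l, he, hadj, hx, hy, hl⟩ := hmem
  have hreach' : (H.deleteEdges (kprCut H R root k)).Reachable x' y' := by
    rcases Sym2.eq_iff.1 he with ⟨rfl, rfl⟩ | ⟨rfl, rfl⟩
    · exact hreach
    · exact hreach.symm
  have hr := reachable_root hroot (H := H) x'
  set r := root (H.connectedComponentMk x').supp with hr_def
  suffices inv : ∀ {z w : V}, (H.deleteEdges (kprCut H R root k)).Walk z w →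
      H.Reachable x' z → H.dist r z ≤ l → H.dist r w ≤ l by
    obtain ⟨p⟩ := hreach'
    have := inv p (SimpleGraph.Reachable.refl _) hx.le
    omega
  intro z w p
  induction p with
  | nil => exact fun _ h => h
  | @cons z b w hzb p ih =>
    intro hz hle
    rw [SimpleGraph.deleteEdges_adj] at hzb
    refine ih (hz.trans hzb.1.reachable) ?_
    by_contra! hlt
    have hstep := (hr.trans hz).dist_le_succ_of_adj hzb.1
    have hc : H.connectedComponentMk z = H.connectedComponentMk x' :=
      SimpleGraph.ConnectedComponent.sound hz.symm
    refine hzb.2 ⟨z, b, l, rfl, hzb.1, ?_, ?_, ?_⟩ <;> rw [hc]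
    · rw [← hr_def]; omega
    · rw [← hr_def]; omega
    · exact hl

theorem RemovesBetweenComponents.union_kprCut {V : Type*} {G : SimpleGraph V} {F : Set (Sym2 V)}
    (hF : RemovesBetweenComponents G F) {R : ℕ} {root : Set V → V} (hroot : IsRootRule root)
    (k : (G.deleteEdges F).ConnectedComponent → Fin R) :
    RemovesBetweenComponents G (F ∪ kprCut (G.deleteEdges F) R root k) := by
  intro x y hxy hreach hmem
  rw [← SimpleGraph.deleteEdges_deleteEdges] at hreach
  rcases hmem with h | h
  · exact hF x y hxy (hreach.mono (SimpleGraph.deleteEdges_le _)) h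
  · exact not_reachable_of_mem_kprCut hroot k h hreach

theorem exists_kprCut_of_mem_support_kprPhase {V : Type*} [Finite V] {G : SimpleGraph V} {R : ℕ}
    [NeZero R] {root : Set V → V} {F F' : Set (Sym2 V)}
    (h : F' ∈ (kprPhase G R root F).support) :
    ∃ k, F' = F ∪ kprCut (G.deleteEdges F) R root k := by
  rw [kprPhase] at h
  obtain ⟨k, -, hk⟩ := (PMF.mem_support_map_iff _ _ _).1 h
  exact ⟨k, hk.symm⟩

theorem SimpleGraph.supp_connectedComponentMk {V : Type*} {H : SimpleGraph V} (u : V) :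
    (H.connectedComponentMk u).supp = {x | H.Reachable u x} := by
  ext x
  exact ⟨fun h => (SimpleGraph.ConnectedComponent.exact h).symm,
    fun h => SimpleGraph.ConnectedComponent.sound (SimpleGraph.Reachable.symm h)⟩

/-- An edge in the component of `u` survives unless the lower of its ends has the sampled level. -/
theorem SimpleGraph.Adj.deleteEdges_kprCut {V : Type*} {H : SimpleGraph V} {R : ℕ} {root : Set V → V}
    {k : H.ConnectedComponent → Fin R} {u x y r : V} (hxy : H.Adj x y) (hux : H.Reachable u x)
    (hr : root (H.connectedComponentMk u).supp = r)
    (h1 : H.dist r y = H.dist r x + 1 →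
      ¬ H.dist r x ≡ (k (H.connectedComponentMk u) : ℕ) [MOD R])
    (h2 : H.dist r x = H.dist r y + 1 →
      ¬ H.dist r y ≡ (k (H.connectedComponentMk u) : ℕ) [MOD R]) :
    (H.deleteEdges (kprCut H R root k)).Adj x y := by
  rw [SimpleGraph.deleteEdges_adj]
  refine ⟨hxy, ?_⟩
  rintro ⟨x', y', l, he, hadj, hx, hy, hl⟩
  have hc : ∀ z, H.Reachable u z → H.connectedComponentMk z = H.connectedComponentMk u :=
    fun z hz => SimpleGraph.ConnectedComponent.sound hz.symm
  rcases Sym2.eq_iff.1 he with ⟨rfl, rfl⟩ | ⟨rfl, rfl⟩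
  · rw [hc _ hux, hr] at hx hy
    rw [hc _ hux] at hl
    subst hx
    exact h1 hy hl
  · rw [hc _ (hux.trans hxy.reachable), hr] at hx hy
    rw [hc _ (hux.trans hxy.reachable)] at hl
    subst hx
    exact h2 hy hl

/-- This lets intactness of a hemisphere or of the equator be expressed by vertex sets alone. -/
theorem RemovesBetweenComponents.adj {V : Type*} {G : SimpleGraph V} {F : Set (Sym2 V)}
    (hF : RemovesBetweenComponents G F) {u x y : V} (hx : (G.deleteEdges F).Reachable u x)
    (hy : (G.deleteEdges F).Reachable u y)
    (hxy : G.Adj x y) : (G.deleteEdges F).Adj x y := by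
  rw [SimpleGraph.deleteEdges_adj]
  exact ⟨hxy, hF x y hxy (hx.symm.trans hy)⟩

/-- Cut levels are at least `R` apart. With `2 * d < R`, a cut below level `d` thus excludes any cut
at levels from `d` to `2 * d - 1`. -/
theorem not_modEq_of_lt_of_le {R l l' k : ℕ} (h : l ≡ k [MOD R]) (h1 : l < l')
    (h2 : l' < l + R) : ¬ l' ≡ k [MOD R] := by
  intro h'
  have := (Nat.modEq_iff_dvd' h1.le).1 (h.trans h'.symm)
  have := Nat.le_of_dvd (by omega) this
  omega

/-- Going up a chain of integers. -/
theorem SimpleGraph.reachable_of_int_chain {V : Type*} {H : SimpleGraph V} {p : ℤ → V} {b c : ℤ}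
    (h : ∀ a, b ≤ a → a < c → H.Adj (p a) (p (a + 1))) {a : ℤ} (hba : b ≤ a) (hac : a ≤ c) :
    H.Reachable (p b) (p a) := by
  induction a, hba using Int.leInduction with
  | base => exact SimpleGraph.Reachable.refl _
  | succ a hba ih => exact (ih (by omega)).trans (h a hba (by omega)).reachable

theorem SimpleGraph.dist_le_of_int_chain {V : Type*} {H : SimpleGraph V} {p : ℤ → V} {b c : ℤ}
    {r : V} (hr : H.Reachable r (p b))
    (h : ∀ a, b ≤ a → a < c → H.Adj (p a) (p (a + 1))) {a : ℤ} (hba : b ≤ a) (hac : a ≤ c) :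
    (H.dist r (p a) : ℤ) ≤ H.dist r (p b) + (a - b) := by
  induction a, hba using Int.leInduction with
  | base => simp
  | succ a hba ih =>
    have h1 := ih (by omega)
    have h2 := (hr.trans (SimpleGraph.reachable_of_int_chain h hba
      (by omega))).dist_le_succ_of_adj (h a hba (by omega))
    omega

/-! ### The abstract globe and the adversarial roots. -/

/-- `P a j` is the point of longitude `a` and latitude `j` on a globe with `3 * d` meridians that
run from the pole `j = d` to the pole `j = -d`, and with one parallel, the equator `j = 0`.
The functions `latitude` and `longitude` bound distances from below. -/
structure IsGlobe {V : Type*} (G : SimpleGraph V) (d : ℤ) (P : ℤ → ℤ → V) : Prop where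
  north : ∀ a ∈ Set.Icc (-1) (3 * d - 2), P a d = P (-1) d
  south : ∀ a ∈ Set.Icc (-1) (3 * d - 2), P a (-d) = P (-1) (-d)
  meridian : ∀ a ∈ Set.Icc (-1) (3 * d - 2), ∀ j, -d ≤ j → j < d → G.Adj (P a j) (P a (j + 1))
  equator : ∀ a, -1 ≤ a → a < 3 * d - 2 → G.Adj (P a 0) (P (a + 1) 0)
  wrap : G.Adj (P (3 * d - 2) 0) (P (-1) 0)
  latitude : ∃ f : V → ℤ, (∀ x y, G.Adj x y → |f x - f y| ≤ 1) ∧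
    ∀ a ∈ Set.Icc (-1) (3 * d - 2), ∀ j ∈ Set.Icc (-d) d, f (P a j) = j
  longitude : ∀ c ∈ Set.Icc (d - 1) (2 * d - 1), ∃ f : V → ℤ,
    (∀ x y, G.Adj x y → |f x - f y| ≤ 1) ∧
    ∀ a ∈ Set.Icc (-1) (3 * d - 2), f (P a 0) = min d |a - c|

/-- The hemisphere between the equator and the pole `j = d` is contained in `S`. -/
def ContainsNorth {V : Type*} (d : ℤ) (P : ℤ → ℤ → V) (S : Set V) : Prop :=
  ∀ a ∈ Set.Icc (-1) (3 * d - 2), ∀ j ∈ Set.Icc 0 d, P a j ∈ S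

/-- The equator is contained in `S`. -/
def ContainsEquator {V : Type*} (d : ℤ) (P : ℤ → ℤ → V) (S : Set V) : Prop :=
  ∀ a ∈ Set.Icc (-1) (3 * d - 2), P a 0 ∈ S

open Classical in
/-- The adversarial root: a pole whose hemisphere is still intact, or else the midpoint of the long
arc of the equator between the points of longitude `-1` and `2 * d - 1`. -/
noncomputable def globeRoot {V : Type*} (d : ℤ) (P : ℤ → ℤ → V) (S : Set V) : V :=
  if ContainsNorth d P S then P (-1) d
  else if ContainsNorth d (fun a j => P a (-j)) S then P (-1) (-d)
  else if P (d - 1) 0 ∈ S then P (d - 1) 0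
  else if h : S.Nonempty then h.some else P 0 0

theorem isRootRule_globeRoot {V : Type*} {d : ℤ} (hd : 1 ≤ d) (P : ℤ → ℤ → V) :
    IsRootRule (globeRoot d P) := by
  intro S hS
  unfold globeRoot
  split_ifs with h1 h2 h3
  · exact h1 _ ⟨le_rfl, by omega⟩ _ ⟨by omega, le_rfl⟩
  · exact h2 _ ⟨le_rfl, by omega⟩ _ ⟨by omega, le_rfl⟩
  · exact h3
  · exact hS.some_mem

/-! ### The three phases on a globe. -/

namespace IsGlobe

variable {V : Type*} {G : SimpleGraph V} {d : ℤ} {P : ℤ → ℤ → V}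

/-- Reflection in the equator reduces statements about the south pole to the north pole. -/
theorem flip (h : IsGlobe G d P) : IsGlobe G d (fun a j => P a (-j)) where
  north := h.south
  south a ha := by simpa using h.north a ha
  meridian a ha j h1 h2 := by
    have := (h.meridian a ha (-(j + 1)) (by omega) (by omega)).symm
    simpa using this
  equator a h1 h2 := by simpa using h.equator a h1 h2
  wrap := by simpa using h.wrap
  latitude := by
    obtain ⟨f, hf, hP⟩ := h.latitude
    refine ⟨fun x => - f x, fun x y hxy => ?_, fun a ha j hj => ?_⟩
    · have := abs_le.1 (hf x y hxy)
      exact abs_le.2 ⟨by linarith, by linarith⟩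
    · change - f (P a (-j)) = j
      rw [hP a ha (-j) ⟨by linarith [hj.2], by linarith [hj.1]⟩, neg_neg]
  longitude c hc := by simpa using h.longitude c hc

/-- In the component of `u` rooted at the pole `j = d`, the level of `P a j` is `d - j` as long as
the meridians are intact down to latitude `j`. -/
theorem dist_pole (hG : IsGlobe G d P) {F : Set (Sym2 V)} {u : V}
    (hF : RemovesBetweenComponents G F) {b : ℤ} (hb : b ∈ Set.Icc (-d) d) (hd : 1 ≤ d)
    (hS : ∀ a ∈ Set.Icc (-1) (3 * d - 2), ∀ j ∈ Set.Icc b d,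
      (G.deleteEdges F).Reachable u (P a j))
    {a j : ℤ} (ha : a ∈ Set.Icc (-1) (3 * d - 2)) (hj : j ∈ Set.Icc b d) :
    ((G.deleteEdges F).dist (P (-1) d) (P a j) : ℤ) = d - j := by
  obtain ⟨f, hf, hP⟩ := hG.latitude
  have hbase : P a d = P (-1) d := hG.north a ha
  have hpole : (G.deleteEdges F).Reachable u (P (-1) d) := by
    rw [← hbase]; exact hS a ha d ⟨hb.2, le_rfl⟩
  apply le_antisymm
  · have := SimpleGraph.dist_le_of_int_chain (H := G.deleteEdges F) (r := P (-1) d)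
      (p := fun i => P a (-i)) (b := -d) (c := -b) (by simp [hbase]) (fun i h1 h2 => by
        have e : P a (-i) = P a (-(i + 1) + 1) := by congr 1; ring
        refine hF.adj (hS a ha _ ⟨by omega, by omega⟩) (hS a ha _ ⟨by omega, by omega⟩) ?_
        rw [e]
        exact (hG.meridian a ha (-(i + 1)) (by linarith [hb.1]) (by omega)).symm)
      (a := -j) (by linarith [hj.2]) (by linarith [hj.1])
    simp only [neg_neg, hbase, SimpleGraph.dist_self] at this
    push_cast at this
    linarith
  · have hf' : ∀ x y, G.Adj x y → |(-f x) - (-f y)| ≤ 1 := fun x y hxy => by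
      have := abs_le.1 (hf x y hxy)
      exact abs_le.2 ⟨by linarith, by linarith⟩
    have := SimpleGraph.sub_le_dist (G.deleteEdges_le F) (f := fun x => - f x) hf'
      (hpole.symm.trans (hS a ha j hj))
    rw [hP a ha j ⟨hb.1.trans hj.1, hj.2⟩, ← hbase, hP a ha d ⟨by omega, le_rfl⟩] at this
    rw [← hbase]
    linarith

/-- If the root is the pole of an intact hemisphere, then the phase keeps the equator. -/
theorem containsEquator_of_root_pole (hG : IsGlobe G d P) (hd : 1 ≤ d) {F : Set (Sym2 V)}
    (hF : RemovesBetweenComponents G F) {R : ℕ} {root : Set V → V}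
    (k : (G.deleteEdges F).ConnectedComponent → Fin R)
    (hroot : root ((G.deleteEdges F).connectedComponentMk (P (-1) 0)).supp = P (-1) d)
    (hN : ContainsNorth d P {x | (G.deleteEdges F).Reachable (P (-1) 0) x}) :
    ContainsEquator d P
      {x | (G.deleteEdges (F ∪ kprCut (G.deleteEdges F) R root k)).Reachable (P (-1) 0) x} := by
  rw [← SimpleGraph.deleteEdges_deleteEdges]
  intro a ha
  refine SimpleGraph.reachable_of_int_chain (p := fun a => P a 0) (c := 3 * d - 2)
    (fun a h1 h2 => ?_) ha.1 ha.2
  have m0 : (0 : ℤ) ∈ Set.Icc 0 d := ⟨le_rfl, by omega⟩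
  have m1 : a ∈ Set.Icc (-1) (3 * d - 2) := ⟨h1, h2.le⟩
  have m2 : a + 1 ∈ Set.Icc (-1) (3 * d - 2) := ⟨by omega, h2⟩
  have d1 := hG.dist_pole hF (b := 0) ⟨by omega, by omega⟩ hd hN m1 m0
  have d2 := hG.dist_pole hF (b := 0) ⟨by omega, by omega⟩ hd hN m2 m0
  -- Both ends have level `d`, so neither is one level above the other and the edge cannot be cut.
  refine (hF.adj (hN _ m1 _ m0) (hN _ m2 _ m0) (hG.equator a h1 h2)).deleteEdges_kprCut
    (hN _ m1 _ m0) hroot (fun h => ?_) (fun h => ?_) <;> omega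

/-- If the root is a pole and the whole globe is intact, then the phase keeps a hemisphere. -/
theorem containsNorth_or_of_root_pole (hG : IsGlobe G d P) (hd : 1 ≤ d) {F : Set (Sym2 V)}
    (hF : RemovesBetweenComponents G F) {R : ℕ} (hR : 2 * d < R) {root : Set V → V}
    (k : (G.deleteEdges F).ConnectedComponent → Fin R)
    (hroot : root ((G.deleteEdges F).connectedComponentMk (P (-1) 0)).supp = P (-1) d)
    (hN : ContainsNorth d P {x | (G.deleteEdges F).Reachable (P (-1) 0) x})
    (hS : ContainsNorth d (fun a j => P a (-j))
      {x | (G.deleteEdges F).Reachable (P (-1) 0) x}) :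
    let F' := F ∪ kprCut (G.deleteEdges F) R root k
    ContainsNorth d P {x | (G.deleteEdges F').Reachable (P (-1) 0) x} ∨
      ContainsNorth d (fun a j => P a (-j))
        {x | (G.deleteEdges F').Reachable (P (-1) 0) x} := by
  intro F'
  have hE := hG.containsEquator_of_root_pole hd hF k hroot hN
  rw [← SimpleGraph.deleteEdges_deleteEdges] at hE
  simp only [F', ← SimpleGraph.deleteEdges_deleteEdges]
  have hall : ∀ a ∈ Set.Icc (-1) (3 * d - 2), ∀ j ∈ Set.Icc (-d) d,
      (G.deleteEdges F).Reachable (P (-1) 0) (P a j) := by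
    intro a ha j hj
    rcases le_total 0 j with h | h
    · exact hN a ha j ⟨h, hj.2⟩
    · have := hS a ha (-j) ⟨by omega, by linarith [hj.1]⟩
      simpa using this
  have hdist : ∀ a ∈ Set.Icc (-1) (3 * d - 2), ∀ j ∈ Set.Icc (-d) d,
      ((G.deleteEdges F).dist (P (-1) d) (P a j) : ℤ) = d - j := fun a ha j hj =>
    hG.dist_pole hF (b := -d) ⟨le_rfl, by omega⟩ hd hall ha hj
  set κ : ℕ := (k ((G.deleteEdges F).connectedComponentMk (P (-1) 0)) : ℕ) with hκ
  have hedge : ∀ a ∈ Set.Icc (-1) (3 * d - 2), ∀ j, -d ≤ j → j < d →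
      (∀ l : ℕ, (l : ℤ) = d - (j + 1) → ¬ l ≡ κ [MOD R]) →
      ((G.deleteEdges F).deleteEdges (kprCut (G.deleteEdges F) R root k)).Adj
        (P a j) (P a (j + 1)) := by
    intro a ha j h1 h2 hl
    have m1 : j ∈ Set.Icc (-d) d := ⟨h1, h2.le⟩
    have m2 : j + 1 ∈ Set.Icc (-d) d := ⟨by omega, h2⟩
    have d1 := hdist a ha _ m1
    have d2 := hdist a ha _ m2
    refine (hF.adj (hall _ ha _ m1) (hall _ ha _ m2) (hG.meridian a ha j h1 h2)).deleteEdges_kprCut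
      (hall _ ha _ m1) hroot (fun h => ?_) (fun h => ?_)
    · omega
    · exact hl _ (by omega)
  -- Northern meridian edges have lower levels in `[0, d)`, southern ones in `[d, 2 * d)`. A cut
  -- level below `d` spares the south; otherwise the north is spared.
  by_cases hcut : ∃ l : ℕ, (l : ℤ) < d ∧ l ≡ κ [MOD R]
  · right
    obtain ⟨l, hld, hl⟩ := hcut
    intro a ha j hj
    refine (hE a ha).trans ?_
    have := SimpleGraph.reachable_of_int_chain
      (H := (G.deleteEdges F).deleteEdges (kprCut (G.deleteEdges F) R root k))
      (p := fun i => P a (-i)) (b := 0) (c := d) (fun i h1 h2 => by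
        have e : P a (-i) = P a (-(i + 1) + 1) := by congr 1; ring
        simp only [e]
        exact (hedge a ha (-(i + 1)) (by omega) (by omega)
          fun l' hl' => not_modEq_of_lt_of_le hl (by omega) (by omega)).symm) hj.1 hj.2
    simpa using this
  · left
    push Not at hcut
    intro a ha j hj
    refine (hE a ha).trans ?_
    exact SimpleGraph.reachable_of_int_chain (p := fun i => P a i) (c := d) (fun i h1 h2 =>
      hedge a ha i (by omega) h2 fun l hl => hcut l (by omega)) hj.1 hj.2

/-- If the equator is intact and the root is its point of longitude `d - 1`, then the phase keeps
one of the two arcs of the equator between the longitudes `-1` and `2 * d - 1`. -/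
theorem reachable_of_root_equator (hG : IsGlobe G d P) (hd : 1 ≤ d) {F : Set (Sym2 V)}
    (hF : RemovesBetweenComponents G F) {R : ℕ} (hR : 2 * d < R) {root : Set V → V}
    (k : (G.deleteEdges F).ConnectedComponent → Fin R)
    (hroot : root ((G.deleteEdges F).connectedComponentMk (P (-1) 0)).supp = P (d - 1) 0)
    (hE : ContainsEquator d P {x | (G.deleteEdges F).Reachable (P (-1) 0) x}) :
    (G.deleteEdges (F ∪ kprCut (G.deleteEdges F) R root k)).Reachable
      (P (-1) 0) (P (2 * d - 1) 0) := by
  rw [← SimpleGraph.deleteEdges_deleteEdges]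
  set κ : ℕ := (k ((G.deleteEdges F).connectedComponentMk (P (-1) 0)) : ℕ) with hκ
  have hm : d - 1 ∈ Set.Icc (-1) (3 * d - 2) := ⟨by omega, by omega⟩
  obtain ⟨f, hf, hP⟩ := hG.longitude (d - 1) ⟨le_rfl, by omega⟩
  have hadj : ∀ a, -1 ≤ a → a < 3 * d - 2 → (G.deleteEdges F).Adj (P a 0) (P (a + 1) 0) :=
    fun a h1 h2 => hF.adj (hE a ⟨h1, h2.le⟩) (hE (a + 1) ⟨by omega, h2⟩) (hG.equator a h1 h2)
  -- This bound survives shortcuts through the poles or the closing edge, because the function is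
  -- Lipschitz on the whole globe.
  have hlow : ∀ a ∈ Set.Icc (-1) (3 * d - 2),
      min d |a - (d - 1)| ≤ ((G.deleteEdges F).dist (P (d - 1) 0) (P a 0) : ℤ) := by
    intro a ha
    have := SimpleGraph.sub_le_dist (G.deleteEdges_le F) hf ((hE _ hm).symm.trans (hE a ha))
    rw [hP a ha, hP _ hm, sub_self, abs_zero, min_eq_right (by omega : (0 : ℤ) ≤ d)] at this
    simpa using this
  have hup : ∀ a, d - 1 ≤ a → a ≤ 3 * d - 2 →
      ((G.deleteEdges F).dist (P (d - 1) 0) (P a 0) : ℤ) ≤ a - (d - 1) := by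
    intro a h1 h2
    have := SimpleGraph.dist_le_of_int_chain (H := G.deleteEdges F) (r := P (d - 1) 0)
      (p := fun a => P a 0) (SimpleGraph.Reachable.refl _)
      (fun a h1 h2 => hadj a (by omega) h2) h1 h2
    simpa using this
  have hup' : ∀ a, -1 ≤ a → a ≤ d - 1 →
      ((G.deleteEdges F).dist (P (d - 1) 0) (P a 0) : ℤ) ≤ d - 1 - a := by
    intro a h1 h2
    have := SimpleGraph.dist_le_of_int_chain (H := G.deleteEdges F) (r := P (d - 1) 0)
      (p := fun a => P (-a) 0) (b := -(d - 1)) (c := 1) (a := -a)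
      (by rw [neg_neg]) (fun a h1 h2 => by
        have e : P (-a) 0 = P (-(a + 1) + 1) 0 := by congr 1; ring
        simp only [e]
        exact (hadj (-(a + 1)) (by omega) (by omega)).symm) (by omega) (by omega)
    simp only [neg_neg, SimpleGraph.dist_self] at this
    push_cast at this
    linarith
  -- A cut level `l < d` spares the short arc, all of whose vertices have level at least `d`. If
  -- there is none, the long arc survives, since its vertices have level at most `d`.
  by_cases hcut : ∃ l : ℕ, (l : ℤ) < d ∧ l ≡ κ [MOD R]
  · obtain ⟨l, hld, hl⟩ := hcut
    have hsurv : ∀ a b, a ∈ Set.Icc (2 * d - 1) (3 * d - 2) →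
        b = -1 ∨ b ∈ Set.Icc (2 * d - 1) (3 * d - 2) →
        (G.deleteEdges F).Adj (P a 0) (P b 0) →
        ((G.deleteEdges F).deleteEdges (kprCut (G.deleteEdges F) R root k)).Adj
          (P a 0) (P b 0) := by
      intro a b ha hb hab
      have hb' : b ∈ Set.Icc (-1) (3 * d - 2) := by
        rcases hb with rfl | hb
        · exact ⟨by omega, by omega⟩
        · exact ⟨by linarith [hb.1], hb.2⟩
      have ha' : a ∈ Set.Icc (-1) (3 * d - 2) := ⟨by linarith [ha.1], ha.2⟩
      have l1 := hlow a ha'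
      have l2 := hlow b hb'
      have u1 := hup a (by linarith [ha.1]) ha.2
      have u2 : ((G.deleteEdges F).dist (P (d - 1) 0) (P b 0) : ℤ) ≤ 2 * d := by
        rcases hb with rfl | hb
        · have := hup' (-1) le_rfl (by omega)
          omega
        · have := hup b (by linarith [hb.1]) hb.2
          linarith [hb.2]
      have ha1 := ha.1
      have ha2 := ha.2
      have hb1 : d ≤ |b - (d - 1)| := by
        rcases hb with rfl | hb
        · rw [le_abs]; right; omega
        · rw [le_abs]; left; linarith [hb.1]
      rw [min_eq_left hb1] at l2
      rw [min_eq_left (by rw [le_abs]; left; omega)] at l1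
      refine hab.deleteEdges_kprCut (hE _ ha') hroot (fun h => ?_) (fun h => ?_)
      · exact not_modEq_of_lt_of_le hl (by omega) (by omega)
      · exact not_modEq_of_lt_of_le hl (by omega) (by omega)
    refine SimpleGraph.Reachable.symm (SimpleGraph.Reachable.trans ?_ (hsurv (3 * d - 2) (-1)
      ⟨by omega, le_rfl⟩ (Or.inl rfl) ?_).reachable)
    · exact SimpleGraph.reachable_of_int_chain (p := fun a => P a 0) (c := 3 * d - 2)
        (fun a h1 h2 => hsurv a (a + 1) ⟨h1, h2.le⟩ (Or.inr ⟨by omega, h2⟩)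
          (hadj a (by omega) h2)) (by omega) le_rfl
    · exact hF.adj (hE _ ⟨by omega, le_rfl⟩) (hE _ ⟨le_rfl, by omega⟩) hG.wrap
  · push Not at hcut
    refine SimpleGraph.reachable_of_int_chain (p := fun a => P a 0) (c := 2 * d - 1)
        (fun a h1 h2 => ?_) (by omega) le_rfl
    have hle : ∀ b, -1 ≤ b → b ≤ 2 * d - 1 →
        ((G.deleteEdges F).dist (P (d - 1) 0) (P b 0) : ℤ) ≤ d := by
      intro b h1 h2
      rcases le_total b (d - 1) with h | h
      · linarith [hup' b h1 h]
      · linarith [hup b h (by omega)]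
    have i1 := hle a h1 (by omega)
    have i2 := hle (a + 1) (by omega) (by omega)
    refine (hadj a h1 (by omega)).deleteEdges_kprCut (hE _ ⟨h1, by omega⟩) hroot
      (fun h => hcut _ (by omega)) (fun h => hcut _ (by omega))

/-- The cluster of the point `P (-1) 0` of a globe after the edges in `F` have been removed. -/
def cluster (G : SimpleGraph V) (P : ℤ → ℤ → V) (F : Set (Sym2 V)) : Set V :=
  {x | (G.deleteEdges F).Reachable (P (-1) 0) x}

theorem containsEquator_step (hG : IsGlobe G d P) (hd : 1 ≤ d) {F : Set (Sym2 V)}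
    (hF : RemovesBetweenComponents G F) {R : ℕ}
    (k : (G.deleteEdges F).ConnectedComponent → Fin R)
    (h : ContainsNorth d P (cluster G P F) ∨
      ContainsNorth d (fun a j => P a (-j)) (cluster G P F)) :
    ContainsEquator d P
      (cluster G P (F ∪ kprCut (G.deleteEdges F) R (globeRoot d P) k)) := by
  by_cases hN : ContainsNorth d P (cluster G P F)
  · refine hG.containsEquator_of_root_pole hd hF k ?_ hN
    rw [SimpleGraph.supp_connectedComponentMk]
    exact if_pos hN
  · have hS := h.resolve_left hN
    have key := hG.flip.containsEquator_of_root_pole hd hF (root := globeRoot d P) k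
      (by
        rw [neg_zero, SimpleGraph.supp_connectedComponentMk]
        exact (if_neg hN).trans (if_pos hS))
      (by rw [neg_zero]; exact hS)
    simpa [ContainsEquator, cluster] using key

theorem containsNorth_step (hG : IsGlobe G d P) (hd : 1 ≤ d) {F : Set (Sym2 V)}
    (hF : RemovesBetweenComponents G F) {R : ℕ} (hR : 2 * d < R)
    (k : (G.deleteEdges F).ConnectedComponent → Fin R)
    (hN : ContainsNorth d P (cluster G P F))
    (hS : ContainsNorth d (fun a j => P a (-j)) (cluster G P F)) :
    let F' := F ∪ kprCut (G.deleteEdges F) R (globeRoot d P) k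
    ContainsNorth d P (cluster G P F') ∨
      ContainsNorth d (fun a j => P a (-j)) (cluster G P F') :=
  hG.containsNorth_or_of_root_pole hd hF hR k
    (by rw [SimpleGraph.supp_connectedComponentMk]; exact if_pos hN) hN hS

/-- The root rule still prefers a pole if a hemisphere has survived so far; then the whole equator
is kept, which is more than enough. -/
theorem reachable_step (hG : IsGlobe G d P) (hd : 1 ≤ d) {F : Set (Sym2 V)}
    (hF : RemovesBetweenComponents G F) {R : ℕ} (hR : 2 * d < R)
    (k : (G.deleteEdges F).ConnectedComponent → Fin R)
    (hE : ContainsEquator d P (cluster G P F)) :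
    (G.deleteEdges (F ∪ kprCut (G.deleteEdges F) R (globeRoot d P) k)).Reachable
      (P (-1) 0) (P (2 * d - 1) 0) := by
  by_cases hN : ContainsNorth d P (cluster G P F)
  · exact hG.containsEquator_step hd hF k (Or.inl hN) _ ⟨by omega, by omega⟩
  by_cases hS : ContainsNorth d (fun a j => P a (-j)) (cluster G P F)
  · exact hG.containsEquator_step hd hF k (Or.inr hS) _ ⟨by omega, by omega⟩
  · refine hG.reachable_of_root_equator hd hF hR k ?_ hE
    rw [SimpleGraph.supp_connectedComponentMk]
    exact (if_neg hN).trans ((if_neg hS).trans (if_pos (hE _ ⟨by omega, by omega⟩)))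

theorem containsNorth_univ (hG : IsGlobe G d P) (hd : 1 ≤ d) :
    ContainsNorth d P (cluster G P ∅) := by
  intro a ha j hj
  simp only [cluster, SimpleGraph.deleteEdges_empty, Set.mem_ofPred_eq]
  exact (SimpleGraph.reachable_of_int_chain (p := fun a => P a 0) (c := 3 * d - 2)
    (fun a h1 h2 => hG.equator a h1 h2) ha.1 ha.2).trans
    (SimpleGraph.reachable_of_int_chain (p := fun j => P a j) (c := d)
      (fun j h1 h2 => hG.meridian a ha j (by omega) h2) hj.1 hj.2)

/-- No outcome in the support separates the two points: the surviving part shrinks from the globe to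
a hemisphere, to the equator, to an arc. -/
theorem kprSepProb_eq_zero [Finite V] (hG : IsGlobe G d P) (hd : 1 ≤ d) {R : ℕ} [NeZero R]
    (hR : 2 * d < R) :
    kprSepProb G R (globeRoot d P) (P (-1) 0) (P (2 * d - 1) 0) = 0 := by
  have hroot := isRootRule_globeRoot hd P
  rw [kprSepProb, PMF.toOuterMeasure_apply_eq_zero_iff, Set.disjoint_left]
  intro F hF
  simp only [kpr, kprPhases, PMF.pure_bind] at hF
  obtain ⟨F₂, hF₂, hF⟩ := (PMF.mem_support_bind_iff _ _ _).1 hF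
  obtain ⟨F₁, hF₁, hF₂⟩ := (PMF.mem_support_bind_iff _ _ _).1 hF₂
  obtain ⟨k₁, rfl⟩ := exists_kprCut_of_mem_support_kprPhase hF₁
  obtain ⟨k₂, rfl⟩ := exists_kprCut_of_mem_support_kprPhase hF₂
  obtain ⟨k₃, rfl⟩ := exists_kprCut_of_mem_support_kprPhase hF
  have r₀ : RemovesBetweenComponents G ∅ := fun x y _ _ h => h
  have r₁ := r₀.union_kprCut hroot k₁
  have r₂ := r₁.union_kprCut hroot k₂
  have hS := hG.flip.containsNorth_univ hd
  simp only [cluster, neg_zero] at hS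
  have s₁ := hG.containsNorth_step hd r₀ hR k₁ (hG.containsNorth_univ hd) hS
  have s₂ := hG.containsEquator_step hd r₁ k₂ s₁
  exact not_not.2 (hG.reachable_step hd r₂ hR k₃ s₂)

theorem dist_eq (hG : IsGlobe G d P) (hd : 1 ≤ d) :
    (G.dist (P (-1) 0) (P (2 * d - 1) 0) : ℤ) = d := by
  have hchain : ∀ a, 2 * d - 1 ≤ a → a < 3 * d - 2 → G.Adj (P a 0) (P (a + 1) 0) :=
    fun a h1 h2 => hG.equator a (by omega) h2
  have hreach : G.Reachable (P (2 * d - 1) 0) (P (3 * d - 2) 0) :=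
    SimpleGraph.reachable_of_int_chain (p := fun a => P a 0) hchain (by omega) le_rfl
  apply le_antisymm
  · have h1 := SimpleGraph.dist_le_of_int_chain (p := fun a => P a 0)
      (SimpleGraph.Reachable.refl (P (2 * d - 1) 0)) hchain (a := 3 * d - 2) (by omega) le_rfl
    have h2 := hreach.dist_le_succ_of_adj hG.wrap
    simp only [SimpleGraph.dist_self] at h1
    rw [SimpleGraph.dist_comm]
    push_cast at h1
    omega
  -- Centred at longitude `2 * d - 1`, the function reaches its cap `d` at longitude `-1`, which is
  -- `2 * d` away along the long arc.
  · obtain ⟨f, hf, hP⟩ := hG.longitude (2 * d - 1) ⟨by omega, le_rfl⟩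
    have := SimpleGraph.sub_le_dist le_rfl hf (hreach.trans hG.wrap.reachable)
    rw [hP _ ⟨le_rfl, by omega⟩, hP _ ⟨by omega, by omega⟩, sub_self, abs_zero,
      min_eq_right (by omega : (0 : ℤ) ≤ d),
      min_eq_left (by rw [le_abs]; right; omega)] at this
    rw [SimpleGraph.dist_comm]
    simpa using this

end IsGlobe

/-! ### A planar drawing of the globe. -/

/-- The lattice point at which the point of longitude `a` and latitude `j` of the globe is drawn.
All longitudes agree at the poles `j = d` and `j = -d`. -/
def globePoint (d a j : ℤ) : ℤ × ℤ := ((d - |j|) * a, j)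

/-- The globe on its lattice points, with `3 * d` meridians and an equator. -/
def globeGraph (d : ℤ) : SimpleGraph (ℤ × ℤ) :=
  SimpleGraph.fromRel fun p q =>
    (∃ a ∈ Set.Icc (-1) (3 * d - 2), ∃ j, -d ≤ j ∧ j < d ∧
      p = globePoint d a j ∧ q = globePoint d a (j + 1)) ∨
    (∃ a, -1 ≤ a ∧ a < 3 * d - 2 ∧ p = globePoint d a 0 ∧ q = globePoint d (a + 1) 0) ∨
    (p = globePoint d (3 * d - 2) 0 ∧ q = globePoint d (-1) 0)

/-- The inclusion of the integer lattice in the plane. -/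
def latticeToPlane (p : ℤ × ℤ) : ℝ × ℝ := (p.1, p.2)

theorem latticeToPlane_injective : Function.Injective latticeToPlane := by
  intro p q h
  simp only [latticeToPlane, Prod.mk.injEq, Int.cast_inj] at h
  exact Prod.ext h.1 h.2

/-- `e` is the edge of the meridian `a` from latitude `j` to latitude `j + 1`. -/
def IsMeridianEdge (d a j : ℤ) (e : Sym2 (ℤ × ℤ)) : Prop :=
  a ∈ Set.Icc (-1) (3 * d - 2) ∧ -d ≤ j ∧ j < d ∧ e = s(globePoint d a j, globePoint d a (j + 1))

/-- `e` is the edge of the equator from longitude `a` to longitude `a + 1`. -/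
def IsEquatorEdge (d a : ℤ) (e : Sym2 (ℤ × ℤ)) : Prop :=
  -1 ≤ a ∧ a < 3 * d - 2 ∧ e = s(globePoint d a 0, globePoint d (a + 1) 0)

/-- `e` is the edge that closes the equator. -/
def IsWrapEdge (d : ℤ) (e : Sym2 (ℤ × ℤ)) : Prop :=
  e = s(globePoint d (3 * d - 2) 0, globePoint d (-1) 0)

open Classical in
/-- The drawing of the globe: the edge that closes the equator is a parabola over the northern
hemisphere, and every other edge is a segment. -/
noncomputable def globeArc (d : ℤ) (e : Sym2 (ℤ × ℤ)) : Set (ℝ × ℝ) :=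
  if IsWrapEdge d e then
    {q | -d ≤ q.1 ∧ q.1 ≤ d * (3 * d - 2) ∧ q.2 = 2 * (q.1 + d) * (d * (3 * d - 2) - q.1)}
  else convexHull ℝ (latticeToPlane '' {p | p ∈ e})

theorem globeGraph_edge {d : ℤ} {e : Sym2 (ℤ × ℤ)} (he : e ∈ (globeGraph d).edgeSet) :
    (∃ a j, IsMeridianEdge d a j e) ∨ (∃ a, IsEquatorEdge d a e) ∨ IsWrapEdge d e := by
  induction e with | _ p q
  rw [SimpleGraph.mem_edgeSet, globeGraph, SimpleGraph.fromRel_adj] at he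
  rcases he.2 with h | h
  · rcases h with ⟨a, ha, j, h1, h2, rfl, rfl⟩ | ⟨a, h1, h2, rfl, rfl⟩ | ⟨rfl, rfl⟩
    · exact Or.inl ⟨a, j, ha, h1, h2, rfl⟩
    · exact Or.inr (Or.inl ⟨a, h1, h2, rfl⟩)
    · exact Or.inr (Or.inr rfl)
  · rcases h with ⟨a, ha, j, h1, h2, rfl, rfl⟩ | ⟨a, h1, h2, rfl, rfl⟩ | ⟨rfl, rfl⟩
    · exact Or.inl ⟨a, j, ha, h1, h2, Sym2.eq_swap⟩
    · exact Or.inr (Or.inl ⟨a, h1, h2, Sym2.eq_swap⟩)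
    · exact Or.inr (Or.inr Sym2.eq_swap)

theorem not_isWrapEdge_of_isMeridianEdge {d a j : ℤ} {e : Sym2 (ℤ × ℤ)}
    (he : IsMeridianEdge d a j e) : ¬ IsWrapEdge d e := by
  intro h
  obtain ⟨-, -, -, rfl⟩ := he
  simp only [IsWrapEdge, globePoint, Sym2.eq_iff, Prod.mk.injEq] at h
  omega

theorem not_isWrapEdge_of_isEquatorEdge {d a : ℤ} (hd : 1 ≤ d) {e : Sym2 (ℤ × ℤ)}
    (he : IsEquatorEdge d a e) : ¬ IsWrapEdge d e := by
  intro h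
  obtain ⟨h1, h2, rfl⟩ := he
  have hd0 : d ≠ 0 := by omega
  simp only [IsWrapEdge, globePoint, Sym2.eq_iff, Prod.mk.injEq, abs_zero, sub_zero,
    mul_right_inj' hd0] at h
  omega

theorem globeArc_of_not_isWrapEdge {d : ℤ} {p q : ℤ × ℤ} (h : ¬ IsWrapEdge d s(p, q)) :
    globeArc d s(p, q) = segment ℝ (latticeToPlane p) (latticeToPlane q) := by
  rw [globeArc, if_neg h, ← convexHull_pair]
  have : {x | x ∈ s(p, q)} = ({p, q} : Set (ℤ × ℤ)) := by
    ext x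
    simp
  rw [this, Set.image_pair]

theorem IsMeridianEdge.mem_arc {d a j : ℤ} {e : Sym2 (ℤ × ℤ)} (he : IsMeridianEdge d a j e)
    {q : ℝ × ℝ} (hq : q ∈ globeArc d e) :
    (j : ℝ) ≤ q.2 ∧ q.2 ≤ j + 1 ∧ q.1 = (d - |q.2|) * a := by
  have hw := not_isWrapEdge_of_isMeridianEdge he
  obtain ⟨-, -, -, rfl⟩ := he
  rw [globeArc_of_not_isWrapEdge hw] at hq
  obtain ⟨s, t, hs, ht, hst, rfl⟩ := hq
  obtain rfl : s = 1 - t := by linarith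
  have hy : (1 - t) * (j : ℝ) + t * (j + 1) = j + t := by ring
  simp only [latticeToPlane, globePoint, Prod.smul_mk, Prod.mk_add_mk, smul_eq_mul, Int.cast_add,
    Int.cast_one, Int.cast_mul, Int.cast_sub, Int.cast_abs, hy]
  refine ⟨by linarith, by linarith, ?_⟩
  rcases le_or_gt 0 j with h | h
  · have h' : (0 : ℝ) ≤ j := by exact_mod_cast h
    rw [abs_of_nonneg h', abs_of_nonneg (by linarith : (0 : ℝ) ≤ j + 1),
      abs_of_nonneg (by linarith : (0 : ℝ) ≤ j + t)]
    ring
  · have h' : (j : ℝ) + 1 ≤ 0 := by exact_mod_cast h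
    rw [abs_of_nonpos (by linarith : (j : ℝ) ≤ 0), abs_of_nonpos h',
      abs_of_nonpos (by linarith : (j : ℝ) + t ≤ 0)]
    ring

theorem IsEquatorEdge.mem_arc {d a : ℤ} (hd : 1 ≤ d) {e : Sym2 (ℤ × ℤ)} (he : IsEquatorEdge d a e)
    {q : ℝ × ℝ} (hq : q ∈ globeArc d e) :
    (d : ℝ) * a ≤ q.1 ∧ q.1 ≤ d * (a + 1) ∧ q.2 = 0 := by
  have hw := not_isWrapEdge_of_isEquatorEdge hd he
  obtain ⟨-, -, rfl⟩ := he
  rw [globeArc_of_not_isWrapEdge hw] at hq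
  obtain ⟨s, t, hs, ht, hst, rfl⟩ := hq
  obtain rfl : s = 1 - t := by linarith
  have hd' : (1 : ℝ) ≤ d := by exact_mod_cast hd
  simp only [latticeToPlane, globePoint, Prod.smul_mk, Prod.mk_add_mk, smul_eq_mul, abs_zero,
    sub_zero, Int.cast_add, Int.cast_one, Int.cast_mul, Int.cast_zero, mul_zero, add_zero]
  have h1 : 0 ≤ t * d := by positivity
  have h2 : 0 ≤ (1 - t) * d := by positivity
  exact ⟨by linarith, by linarith, trivial⟩

theorem IsWrapEdge.mem_arc {d : ℤ} {e : Sym2 (ℤ × ℤ)} (he : IsWrapEdge d e)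
    {q : ℝ × ℝ} (hq : q ∈ globeArc d e) :
    -(d : ℝ) ≤ q.1 ∧ q.1 ≤ d * (3 * d - 2) ∧
      q.2 = 2 * (q.1 + d) * (d * (3 * d - 2) - q.1) := by
  rwa [globeArc, if_pos he] at hq

/-- The parabola meets the meridians only at its two ends. -/
theorem parabola_meets_meridian {d a x y : ℝ} (hd : 1 ≤ d) (ha : -1 ≤ a) (ha' : a ≤ 3 * d - 2)
    (hyd : y ≤ d) (hx1 : -d ≤ x) (hx2 : x ≤ d * (3 * d - 2))
    (hy : y = 2 * (x + d) * (d * (3 * d - 2) - x)) (hx : x = (d - |y|) * a) :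
    y = 0 ∧ (a = -1 ∨ a = 3 * d - 2) := by
  have hy0 : 0 ≤ y := by
    rw [hy]
    exact mul_nonneg (by linarith) (by linarith)
  rw [abs_of_nonneg hy0] at hx
  have hM : 1 ≤ 3 * d - 2 := by linarith
  generalize 3 * d - 2 = M at *
  -- Both factors of the parabola become sums of nonnegative terms. If `y > 0`, expanding the
  -- product gives at least `2 * y * d > y`. Without the factor 2 in the parabola, it would pass
  -- through the north pole when `d = 1`.
  have e1 : x + d = y + (d - y) * (a + 1) := by rw [hx]; ring
  have e2 : d * M - x = y * M + (d - y) * (M - a) := by rw [hx]; ring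
  rw [e1, e2] at hy
  have p1 : 0 ≤ (d - y) * (a + 1) := mul_nonneg (by linarith) (by linarith)
  have p2 : 0 ≤ (d - y) * (M - a) := mul_nonneg (by linarith) (by linarith)
  have hylt : y = 0 := by
    by_contra hne
    have hpos : 0 < y := lt_of_le_of_ne hy0 (Ne.symm hne)
    have b1 : y * ((d - y) * (M - a)) + (d - y) * (a + 1) * (y * M) ≥ y * ((d - y) * (M + 1)) := by
      have : 0 ≤ y * ((d - y) * (a + 1)) * (M - 1) :=
        mul_nonneg (mul_nonneg hy0 p1) (by linarith)
      nlinarith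
    have b2 : 0 ≤ (d - y) * (a + 1) * ((d - y) * (M - a)) := mul_nonneg p1 p2
    have b3 : y * y * M ≥ y * y := by nlinarith [mul_pos hpos hpos]
    have b4 : y * ((d - y) * (M + 1)) ≥ y * (d - y) := by
      have : 0 ≤ y * (d - y) * M := mul_nonneg (mul_nonneg hy0 (by linarith)) (by linarith)
      nlinarith
    have b5 : y * d ≥ y := by nlinarith
    nlinarith
  subst hylt
  refine ⟨rfl, ?_⟩
  have : (a + 1) * (M - a) = 0 := by
    have h2 : d * d * ((a + 1) * (M - a)) = 0 := by linarith
    rcases mul_eq_zero.1 h2 with h | h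
    · nlinarith
    · exact h
  rcases mul_eq_zero.1 this with h | h
  · left; linarith
  · right; linarith

/-- `q` is the drawing of a common end of `e` and `f`. -/
def IsCommonEnd (e f : Sym2 (ℤ × ℤ)) (q : ℝ × ℝ) : Prop :=
  q ∈ latticeToPlane '' {p | p ∈ e ∧ p ∈ f}

theorem IsCommonEnd.symm {e f : Sym2 (ℤ × ℤ)} {q : ℝ × ℝ} (h : IsCommonEnd e f q) :
    IsCommonEnd f e q := by
  obtain ⟨p, hp, rfl⟩ := h
  exact ⟨p, hp.symm, rfl⟩

theorem meridian_inter_meridian {d a j a' j' : ℤ} {e f : Sym2 (ℤ × ℤ)}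
    (he : IsMeridianEdge d a j e) (hf : IsMeridianEdge d a' j' f) (hlt : j ≤ j') (hne : e ≠ f)
    {q : ℝ × ℝ} (hqe : q ∈ globeArc d e) (hqf : q ∈ globeArc d f) : IsCommonEnd e f q := by
  obtain ⟨y1, y2, x1⟩ := he.mem_arc hqe
  obtain ⟨y3, y4, x2⟩ := hf.mem_arc hqf
  obtain ⟨-, h1, h2, rfl⟩ := he
  obtain ⟨-, h3, h4, rfl⟩ := hf
  obtain ⟨x, y⟩ := q
  simp only at *
  have c1 : (-d : ℝ) ≤ j := by exact_mod_cast h1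
  have c2 : (j : ℝ) + 1 ≤ d := by exact_mod_cast h2
  have c4 : (j' : ℝ) + 1 ≤ d := by exact_mod_cast h4
  have key : ∀ i : ℤ, y = i → (i = j ∨ i = j + 1) → (i = j' ∨ i = j' + 1) →
      globePoint d a i = globePoint d a' i →
      IsCommonEnd s(globePoint d a j, globePoint d a (j + 1))
        s(globePoint d a' j', globePoint d a' (j' + 1)) (x, y) := by
    intro i hy hi hi' hp
    refine ⟨globePoint d a i, ⟨?_, ?_⟩, ?_⟩
    · rcases hi with rfl | rfl <;> simp
    · rw [hp]; rcases hi' with rfl | rfl <;> simp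
    · simp [latticeToPlane, globePoint, x1, hy]
  -- Two meridians at the same height and abscissa: either the point is a pole, or the meridians
  -- coincide and the edges are consecutive.
  have hprod : (d - |y|) * ((a : ℝ) - a') = 0 := by linarith
  rcases mul_eq_zero.1 hprod with h | h
  · have hy : |y| = d := by linarith
    rcases abs_choice y with hc | hc
    · have hyd : y = d := by linarith
      have e1 : d ≤ j + 1 := by exact_mod_cast (by linarith : (d : ℝ) ≤ j + 1)
      have e2 : d ≤ j' + 1 := by exact_mod_cast (by linarith : (d : ℝ) ≤ j' + 1)
      have hd0 : |d| = d := by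
        have : ((|d| : ℤ) : ℝ) = d := by rw [Int.cast_abs, ← hyd, hc]
        exact_mod_cast this
      exact key d hyd (by omega) (by omega) (by simp [globePoint, hd0])
    · have hyd : y = -d := by linarith
      have e1 : j ≤ -d := by exact_mod_cast (by linarith : (j : ℝ) ≤ -d)
      have e2 : j' ≤ -d := by exact_mod_cast (by linarith : (j' : ℝ) ≤ -d)
      have hd0 : |d| = d := by
        have : ((|d| : ℤ) : ℝ) = d := by rw [Int.cast_abs, ← hy, abs_abs]
        exact_mod_cast this
      exact key (-d) (by rw [hyd]; simp) (by omega) (by omega) (by simp [globePoint, hd0])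
  · have haa : a = a' := by exact_mod_cast (by linarith : (a : ℝ) = a')
    subst haa
    have hjj : j ≠ j' := fun h => hne (by rw [h])
    have e1 : j' ≤ j + 1 := by exact_mod_cast (by linarith : (j' : ℝ) ≤ j + 1)
    obtain rfl : j' = j + 1 := by omega
    refine key (j + 1) ?_ (by omega) (by omega) rfl
    push_cast at *
    linarith

theorem meridian_inter_equator {d a j b : ℤ} (hd : 1 ≤ d) {e f : Sym2 (ℤ × ℤ)}
    (he : IsMeridianEdge d a j e) (hf : IsEquatorEdge d b f)
    {q : ℝ × ℝ} (hqe : q ∈ globeArc d e) (hqf : q ∈ globeArc d f) : IsCommonEnd e f q := by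
  obtain ⟨y1, y2, x1⟩ := he.mem_arc hqe
  obtain ⟨x2, x3, y3⟩ := hf.mem_arc hd hqf
  obtain ⟨-, h1, h2, rfl⟩ := he
  obtain ⟨h3, h4, rfl⟩ := hf
  obtain ⟨x, y⟩ := q
  simp only at *
  have hd' : (0 : ℝ) < d := by exact_mod_cast hd
  subst y3
  rw [abs_zero, sub_zero] at x1
  subst x1
  have e1 : b ≤ a := by exact_mod_cast le_of_mul_le_mul_left x2 hd'
  have e2 : a ≤ b + 1 := by exact_mod_cast le_of_mul_le_mul_left x3 hd'
  have e3 : j ≤ 0 := by exact_mod_cast y1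
  have e4 : 0 ≤ j + 1 := by exact_mod_cast y2
  refine ⟨globePoint d a 0, ⟨?_, ?_⟩, by simp [latticeToPlane, globePoint]⟩
  · have : j = 0 ∨ j = -1 := by omega
    rcases this with rfl | rfl <;> simp
  · have : a = b ∨ a = b + 1 := by omega
    rcases this with rfl | rfl <;> simp

theorem meridian_inter_wrap {d a j : ℤ} (hd : 1 ≤ d) {e f : Sym2 (ℤ × ℤ)}
    (he : IsMeridianEdge d a j e) (hf : IsWrapEdge d f)
    {q : ℝ × ℝ} (hqe : q ∈ globeArc d e) (hqf : q ∈ globeArc d f) : IsCommonEnd e f q := by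
  obtain ⟨y1, y2, x1⟩ := he.mem_arc hqe
  obtain ⟨x2, x3, y3⟩ := hf.mem_arc hqf
  obtain ⟨⟨ha, ha'⟩, h1, h2, rfl⟩ := he
  obtain rfl : f = _ := hf
  obtain ⟨x, y⟩ := q
  simp only at *
  have c2 : (j : ℝ) + 1 ≤ d := by exact_mod_cast h2
  obtain ⟨hy, hor⟩ := parabola_meets_meridian (a := a) (by exact_mod_cast hd) (by exact_mod_cast ha)
    (by exact_mod_cast ha') (by linarith) x2 x3 y3 x1
  subst hy
  rw [abs_zero, sub_zero] at x1
  subst x1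
  have e3 : j ≤ 0 := by exact_mod_cast y1
  have e4 : 0 ≤ j + 1 := by exact_mod_cast y2
  refine ⟨globePoint d a 0, ⟨?_, ?_⟩, by simp [latticeToPlane, globePoint]⟩
  · have : j = 0 ∨ j = -1 := by omega
    rcases this with rfl | rfl <;> simp
  · have : a = -1 ∨ a = 3 * d - 2 := by
      rcases hor with h | h
      · left; exact_mod_cast h
      · right; exact_mod_cast h
    rcases this with rfl | rfl <;> simp

theorem equator_inter_equator {d b b' : ℤ} (hd : 1 ≤ d) {e f : Sym2 (ℤ × ℤ)}
    (he : IsEquatorEdge d b e) (hf : IsEquatorEdge d b' f) (hle : b ≤ b') (hne : e ≠ f)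
    {q : ℝ × ℝ} (hqe : q ∈ globeArc d e) (hqf : q ∈ globeArc d f) : IsCommonEnd e f q := by
  obtain ⟨x1, x2, y1⟩ := he.mem_arc hd hqe
  obtain ⟨x3, x4, y2⟩ := hf.mem_arc hd hqf
  obtain ⟨h1, h2, rfl⟩ := he
  obtain ⟨h3, h4, rfl⟩ := hf
  obtain ⟨x, y⟩ := q
  simp only at *
  have hd' : (0 : ℝ) < d := by exact_mod_cast hd
  have hbb : b ≠ b' := fun h => hne (by rw [h])
  have e1 : b' ≤ b + 1 := by exact_mod_cast le_of_mul_le_mul_left (x3.trans x2) hd'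
  obtain rfl : b' = b + 1 := by omega
  refine ⟨globePoint d (b + 1) 0, ⟨by simp, by simp⟩, ?_⟩
  push_cast at x3
  have hx : x = d * (b + 1) := le_antisymm x2 x3
  simp [latticeToPlane, globePoint, hx, y1]

theorem equator_inter_wrap {d b : ℤ} (hd : 1 ≤ d) {e f : Sym2 (ℤ × ℤ)}
    (he : IsEquatorEdge d b e) (hf : IsWrapEdge d f)
    {q : ℝ × ℝ} (hqe : q ∈ globeArc d e) (hqf : q ∈ globeArc d f) : IsCommonEnd e f q := by
  obtain ⟨x1, x2, y1⟩ := he.mem_arc hd hqe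
  obtain ⟨x3, x4, y2⟩ := hf.mem_arc hqf
  obtain ⟨h1, h2, rfl⟩ := he
  obtain rfl : f = _ := hf
  obtain ⟨x, y⟩ := q
  simp only at *
  have hd' : (0 : ℝ) < d := by exact_mod_cast hd
  subst y1
  rcases mul_eq_zero.1 y2.symm with h | h
  · have hx : x = d * (-1 : ℤ) := by push_cast; linarith
    subst hx
    have : b ≤ -1 := by exact_mod_cast le_of_mul_le_mul_left x1 hd'
    obtain rfl : b = -1 := by omega
    exact ⟨globePoint d (-1) 0, ⟨by simp, by simp⟩, by simp [latticeToPlane, globePoint]⟩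
  · have hx : x = d * (3 * d - 2 : ℤ) := by push_cast; linarith
    subst hx
    have : 3 * d - 2 ≤ b + 1 := by exact_mod_cast le_of_mul_le_mul_left x2 hd'
    obtain rfl : b = 3 * d - 2 - 1 := by omega
    exact ⟨globePoint d (3 * d - 2) 0, ⟨by simp, by simp⟩, by simp [latticeToPlane, globePoint]⟩

theorem globeArc_inter_globeArc {d : ℤ} (hd : 1 ≤ d) {e f : Sym2 (ℤ × ℤ)}
    (he : e ∈ (globeGraph d).edgeSet) (hf : f ∈ (globeGraph d).edgeSet) (hne : e ≠ f)
    {q : ℝ × ℝ} (hqe : q ∈ globeArc d e) (hqf : q ∈ globeArc d f) : IsCommonEnd e f q := by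
  rcases globeGraph_edge he with ⟨a, j, he⟩ | ⟨b, he⟩ | he <;>
  rcases globeGraph_edge hf with ⟨a', j', hf⟩ | ⟨b', hf⟩ | hf
  · rcases le_total j j' with h | h
    · exact meridian_inter_meridian he hf h hne hqe hqf
    · exact (meridian_inter_meridian hf he h hne.symm hqf hqe).symm
  · exact meridian_inter_equator hd he hf hqe hqf
  · exact meridian_inter_wrap hd he hf hqe hqf
  · exact (meridian_inter_equator hd hf he hqf hqe).symm
  · rcases le_total b b' with h | h
    · exact equator_inter_equator hd he hf h hne hqe hqf
    · exact (equator_inter_equator hd hf he h hne.symm hqf hqe).symm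
  · exact equator_inter_wrap hd he hf hqe hqf
  · exact (meridian_inter_wrap hd hf he hqf hqe).symm
  · exact (equator_inter_wrap hd hf he hqf hqe).symm
  · exact absurd (he.trans hf.symm) hne

/-- The lattice points of the globe. -/
def globeVertices (d : ℤ) : Set (ℤ × ℤ) :=
  {p | ∃ a ∈ Set.Icc (-1) (3 * d - 2), ∃ j ∈ Set.Icc (-d) d, p = globePoint d a j}

/-- Lattice points to the left of the globe, which serve as isolated vertices. -/
def outerVertices (d : ℤ) : Set (ℤ × ℤ) := {p | p.1 < -d ∧ p.2 = 0}

theorem mem_of_latticeToPlane_mem_globeArc {d : ℤ} (hd : 1 ≤ d) {e : Sym2 (ℤ × ℤ)}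
    (he : e ∈ (globeGraph d).edgeSet) {p : ℤ × ℤ} (hp : p ∈ globeVertices d ∪ outerVertices d)
    (hpe : latticeToPlane p ∈ globeArc d e) : p ∈ e := by
  have hd' : (0 : ℝ) < d := by exact_mod_cast hd
  rcases hp with ⟨a, ha, j, hj, rfl⟩ | ⟨hp1, hp2⟩
  · rcases globeGraph_edge he with ⟨b, i, he⟩ | ⟨b, he⟩ | he
    · obtain ⟨y1, y2, x1⟩ := he.mem_arc hpe
      obtain ⟨-, h1, h2, rfl⟩ := he
      simp only [latticeToPlane, globePoint] at y1 y2 x1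
      have e1 : i ≤ j := by exact_mod_cast y1
      have e2 : j ≤ i + 1 := by exact_mod_cast y2
      have e3 : (d - |j|) * a = (d - |j|) * b := by exact_mod_cast x1
      -- At a pole the longitudes `a` and `b` may differ, but the lattice points agree.
      have e4 : globePoint d a j = globePoint d b j := by rw [globePoint, globePoint, e3]
      have : j = i ∨ j = i + 1 := by omega
      rw [e4]
      rcases this with rfl | rfl <;> simp
    · obtain ⟨x1, x2, y1⟩ := he.mem_arc hd hpe
      obtain ⟨h1, h2, rfl⟩ := he
      simp only [latticeToPlane, globePoint] at y1 x1 x2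
      obtain rfl : j = 0 := by exact_mod_cast y1
      rw [abs_zero, sub_zero, Int.cast_mul] at x1 x2
      have e1 : b ≤ a := by exact_mod_cast le_of_mul_le_mul_left x1 hd'
      have e2 : a ≤ b + 1 := by exact_mod_cast le_of_mul_le_mul_left x2 hd'
      have : a = b ∨ a = b + 1 := by omega
      rcases this with rfl | rfl <;> simp
    · obtain ⟨x2, x3, y3⟩ := he.mem_arc hpe
      obtain rfl : e = _ := he
      simp only [latticeToPlane, globePoint] at x2 x3 y3
      obtain ⟨hy, hor⟩ := parabola_meets_meridian (d := d) (a := a) (y := j)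
        (by exact_mod_cast hd) (by exact_mod_cast ha.1) (by exact_mod_cast ha.2)
        (by exact_mod_cast hj.2) x2 x3 y3 (by push_cast; ring)
      obtain rfl : j = 0 := by exact_mod_cast hy
      have : a = -1 ∨ a = 3 * d - 2 := by
        rcases hor with h | h
        · left; exact_mod_cast h
        · right; exact_mod_cast h
      rcases this with rfl | rfl <;> simp
  · exfalso
    have hx : (p.1 : ℝ) < -d := by exact_mod_cast hp1
    rcases globeGraph_edge he with ⟨b, i, he⟩ | ⟨b, he⟩ | he
    · obtain ⟨y1, y2, x1⟩ := he.mem_arc hpe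
      have hb := he.1.1
      simp only [latticeToPlane, hp2, Int.cast_zero, abs_zero, sub_zero] at x1
      have hb' : (-1 : ℝ) ≤ b := by exact_mod_cast hb
      nlinarith
    · obtain ⟨x1, x2, y1⟩ := he.mem_arc hd hpe
      have hb' : (-1 : ℝ) ≤ b := by exact_mod_cast he.1
      simp only [latticeToPlane] at x1
      nlinarith
    · have x2 := (he.mem_arc hpe).1
      simp only [latticeToPlane] at x2
      linarith

theorem exists_path_segment {E : Type*} [AddCommGroup E] [Module ℝ E] [TopologicalSpace E]
    [ContinuousSMul ℝ E] [IsTopologicalAddGroup E] {x y : E} (hxy : x ≠ y) :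
    ∃ γ : _root_.Path x y, Function.Injective γ ∧ Set.range γ = segment ℝ x y := by
  refine ⟨⟨⟨fun t : unitInterval => AffineMap.lineMap x y (t : ℝ), ?_⟩, by simp, by simp⟩, ?_, ?_⟩
  · exact (AffineMap.lineMap_continuous (p := x) (q := y) (R := ℝ)).comp continuous_subtype_val
  · intro s t hst
    exact Subtype.ext (AffineMap.lineMap_injective ℝ hxy hst)
  · rw [segment_eq_image_lineMap]
    ext z
    simp [Set.mem_image]

theorem exists_path_parabola {d : ℤ} (hd : 1 ≤ d) :
    ∃ γ : _root_.Path (latticeToPlane (globePoint d (3 * d - 2) 0))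
        (latticeToPlane (globePoint d (-1) 0)),
      Function.Injective γ ∧
        Set.range γ = globeArc d s(globePoint d (3 * d - 2) 0, globePoint d (-1) 0) := by
  have hd' : (1 : ℝ) ≤ d := by exact_mod_cast hd
  -- The abscissa moves linearly from right to left; `d * (3 * d - 1)` is the distance between the
  -- two ends.
  let c : ℝ → ℝ × ℝ := fun t =>
    (d * (3 * d - 2) - t * (d * (3 * d - 1)),
      2 * (d * (3 * d - 2) - t * (d * (3 * d - 1)) + d) * (t * (d * (3 * d - 1))))
  have hpos : (0 : ℝ) < d * (3 * d - 1) := mul_pos (by linarith) (by linarith)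
  refine ⟨⟨⟨fun t : unitInterval => c t, ?_⟩, ?_, ?_⟩, ?_, ?_⟩
  · fun_prop
  · simp [c, latticeToPlane, globePoint]
  · simp only [c, latticeToPlane, globePoint, Set.Icc.coe_one, Prod.mk.injEq]
    push_cast
    constructor
    · simp; ring
    · ring
  · intro s t hst
    have h1 := congrArg Prod.fst hst
    simp only [Path.coe_mk_mk, c] at h1
    have h2 : (s : ℝ) * (d * (3 * d - 1)) = t * (d * (3 * d - 1)) := by linarith
    exact Subtype.ext (mul_right_cancel₀ hpos.ne' h2)
  · rw [globeArc, if_pos (show IsWrapEdge d _ from rfl)]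
    ext ⟨x, y⟩
    simp only [Path.coe_mk_mk, Set.mem_range, Set.mem_ofPred_eq, c, Prod.mk.injEq]
    constructor
    · rintro ⟨t, rfl, rfl⟩
      have h1 := mul_le_mul_of_nonneg_right t.2.2 hpos.le
      have h2 := mul_nonneg t.2.1 hpos.le
      refine ⟨by linarith, by linarith, by ring⟩
    · rintro ⟨h1, h2, h3⟩
      refine ⟨⟨(d * (3 * d - 2) - x) / (d * (3 * d - 1)), ?_, ?_⟩, ?_, ?_⟩
      · exact div_nonneg (by linarith) hpos.le
      · rw [div_le_one hpos]; linarith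
      · rw [div_mul_cancel₀ _ hpos.ne']; ring
      · rw [div_mul_cancel₀ _ hpos.ne', h3]; ring

theorem exists_path_globeArc {d : ℤ} (hd : 1 ≤ d) {p q : ℤ × ℤ} (h : (globeGraph d).Adj p q) :
    ∃ γ : _root_.Path (latticeToPlane p) (latticeToPlane q),
      Function.Injective γ ∧ Set.range γ = globeArc d s(p, q) := by
  by_cases hw : IsWrapEdge d s(p, q)
  · obtain ⟨γ, hγ, hr⟩ := exists_path_parabola hd
    rcases Sym2.eq_iff.1 hw with ⟨rfl, rfl⟩ | ⟨rfl, rfl⟩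
    · exact ⟨γ, hγ, hr⟩
    · refine ⟨γ.symm, hγ.comp unitInterval.symm_bijective.injective, ?_⟩
      rw [Path.symm_range, hr, Sym2.eq_swap]
  · rw [globeArc_of_not_isWrapEdge hw]
    exact exists_path_segment (latticeToPlane_injective.ne h.ne)

theorem isPlanar_comap_globeGraph {V : Type*} {d : ℤ} (hd : 1 ≤ d) {φ : V → ℤ × ℤ}
    (hφ : Function.Injective φ) (hV : ∀ x, φ x ∈ globeVertices d ∪ outerVertices d) :
    ((globeGraph d).comap φ).IsPlanar := by
  have hmap : ∀ e ∈ ((globeGraph d).comap φ).edgeSet, e.map φ ∈ (globeGraph d).edgeSet := by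
    intro e he
    induction e with | _ x y
    exact he
  have hmem : ∀ (e : Sym2 V) w, φ w ∈ e.map φ → w ∈ e := by
    intro e w hw
    obtain ⟨w', hw', h⟩ := Sym2.mem_map.1 hw
    rwa [← hφ h]
  refine ⟨latticeToPlane ∘ φ, fun e => globeArc d (e.map φ), latticeToPlane_injective.comp hφ,
    fun a b hab => exists_path_globeArc hd hab, fun e he w hw => ?_, ?_⟩
  · exact hmem e w (mem_of_latticeToPlane_mem_globeArc hd (hmap e he) (hV w) hw)
  · rintro e he f hf hne q ⟨hqe, hqf⟩
    obtain ⟨p, ⟨hpe, hpf⟩, rfl⟩ := globeArc_inter_globeArc hd (hmap e he) (hmap f hf)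
      (fun h => hne (Sym2.map.injective hφ h)) hqe hqf
    obtain ⟨w, hw, rfl⟩ := Sym2.mem_map.1 hpe
    exact ⟨w, ⟨hw, hmem f w hpf⟩, rfl⟩

/-! ### The drawn graph satisfies the globe axioms. -/

theorem globeGraph_lipschitz {d : ℤ} {f : ℤ × ℤ → ℤ}
    (hm : ∀ a ∈ Set.Icc (-1) (3 * d - 2), ∀ j, -d ≤ j → j < d →
      |f (globePoint d a j) - f (globePoint d a (j + 1))| ≤ 1)
    (he : ∀ a, -1 ≤ a → a < 3 * d - 2 →
      |f (globePoint d a 0) - f (globePoint d (a + 1) 0)| ≤ 1)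
    (hw : |f (globePoint d (3 * d - 2) 0) - f (globePoint d (-1) 0)| ≤ 1)
    {p q : ℤ × ℤ} (h : (globeGraph d).Adj p q) : |f p - f q| ≤ 1 := by
  rw [globeGraph, SimpleGraph.fromRel_adj] at h
  have main : ∀ p q, ((∃ a ∈ Set.Icc (-1) (3 * d - 2), ∃ j, -d ≤ j ∧ j < d ∧
      p = globePoint d a j ∧ q = globePoint d a (j + 1)) ∨
      (∃ a, -1 ≤ a ∧ a < 3 * d - 2 ∧ p = globePoint d a 0 ∧ q = globePoint d (a + 1) 0) ∨
      (p = globePoint d (3 * d - 2) 0 ∧ q = globePoint d (-1) 0)) → |f p - f q| ≤ 1 := by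
    rintro p q (⟨a, ha, j, h1, h2, rfl, rfl⟩ | ⟨a, h1, h2, rfl, rfl⟩ | ⟨rfl, rfl⟩)
    · exact hm a ha j h1 h2
    · exact he a h1 h2
    · exact hw
  rcases h.2 with h | h
  · exact main _ _ h
  · rw [abs_sub_comm]
    exact main _ _ h

theorem abs_min_sub_min_le_one {d x y : ℤ} (h : |x - y| ≤ 1) : |min d x - min d y| ≤ 1 := by
  have := abs_le.1 h
  exact abs_le.2 ⟨by omega, by omega⟩

theorem isGlobe_comap_globeGraph {V : Type*} {d : ℤ} (hd : 1 ≤ d) {φ : V → ℤ × ℤ}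
    (hφ : Function.Injective φ) {P : ℤ → ℤ → V}
    (hP : ∀ a ∈ Set.Icc (-1) (3 * d - 2), ∀ j ∈ Set.Icc (-d) d, φ (P a j) = globePoint d a j) :
    IsGlobe ((globeGraph d).comap φ) d P := by
  have hd0 : |d| = d := abs_of_nonneg (by omega)
  have m1 : (-1 : ℤ) ∈ Set.Icc (-1) (3 * d - 2) := ⟨le_rfl, by omega⟩
  have m2 : (3 * d - 2 : ℤ) ∈ Set.Icc (-1) (3 * d - 2) := ⟨by omega, le_rfl⟩
  have m0 : (0 : ℤ) ∈ Set.Icc (-d) d := ⟨by omega, by omega⟩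
  have hd00 : d ≠ 0 := by omega
  refine ⟨fun a ha => hφ ?_, fun a ha => hφ ?_, fun a ha j h1 h2 => ?_, fun a h1 h2 => ?_, ?_,
    ⟨fun x => (φ x).2, fun x y hxy => ?_, fun a ha j hj => ?_⟩, fun c hc =>
    ⟨fun x => min d (|(φ x).2| + |(φ x).1 / (d - |(φ x).2|) - c|), fun x y hxy => ?_,
      fun a ha => ?_⟩⟩
  · rw [hP _ ha _ ⟨by omega, le_rfl⟩, hP _ m1 _ ⟨by omega, le_rfl⟩]
    simp [globePoint, hd0]
  · rw [hP _ ha _ ⟨le_rfl, by omega⟩, hP _ m1 _ ⟨le_rfl, by omega⟩]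
    simp [globePoint, hd0]
  · rw [SimpleGraph.comap_adj, hP a ha j ⟨h1, h2.le⟩, hP a ha (j + 1) ⟨by omega, h2⟩, globeGraph,
      SimpleGraph.fromRel_adj]
    exact ⟨fun h => by simp [globePoint] at h, Or.inl (Or.inl ⟨a, ha, j, h1, h2, rfl, rfl⟩)⟩
  · rw [SimpleGraph.comap_adj, hP a ⟨h1, h2.le⟩ 0 m0, hP (a + 1) ⟨by omega, h2⟩ 0 m0, globeGraph,
      SimpleGraph.fromRel_adj]
    exact ⟨fun h => by simp [globePoint, hd00] at h,
      Or.inl (Or.inr (Or.inl ⟨a, h1, h2, rfl, rfl⟩))⟩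
  · rw [SimpleGraph.comap_adj, hP _ m2 0 m0, hP _ m1 0 m0, globeGraph,
      SimpleGraph.fromRel_adj]
    refine ⟨fun h => ?_, Or.inl (Or.inr (Or.inr ⟨rfl, rfl⟩))⟩
    simp only [globePoint, abs_zero, sub_zero, Prod.mk.injEq, and_true, mul_right_inj' hd00] at h
    omega
  · refine globeGraph_lipschitz (f := Prod.snd) (fun a ha j h1 h2 => ?_) (fun a h1 h2 => ?_) ?_ hxy
      <;> simp [globePoint]
  · change (φ (P a j)).2 = j
    rw [hP a ha j hj, globePoint]
  · have hf : ∀ a, ∀ j, -d ≤ j → j ≤ d →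
        min d (|(globePoint d a j).2| +
          |(globePoint d a j).1 / (d - |(globePoint d a j).2|) - c|) = min d (|j| + |a - c|) := by
      intro a j h1 h2
      simp only [globePoint]
      rcases (abs_le.2 ⟨h1, h2⟩).lt_or_eq with h | h
      · rw [Int.mul_ediv_cancel_left _ (by omega)]
      · rw [h, min_eq_left (by simp), min_eq_left (by simp)]
    refine globeGraph_lipschitz
      (f := fun p => min d (|p.2| + |p.1 / (d - |p.2|) - c|))
      (fun a ha j h1 h2 => ?_) (fun a h1 h2 => ?_) ?_ hxy
    · rw [hf a j h1 h2.le, hf a (j + 1) (by omega) h2]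
      apply abs_min_sub_min_le_one
      have := abs_abs_sub_abs_le j (j + 1)
      simpa using this
    · rw [hf a 0 (by omega) (by omega), hf (a + 1) 0 (by omega) (by omega)]
      apply abs_min_sub_min_le_one
      have := abs_abs_sub_abs_le (a - c) (a + 1 - c)
      have e : a - c - (a + 1 - c) = -1 := by ring
      rw [e] at this
      simpa using this
    -- For `c` between `d - 1` and `2 * d - 1`, both ends of the closing edge are at least `d - 1`
    -- away from `c` in longitude, so the capped values lie in `{d - 1, d}`.
    · rw [hf _ 0 (by omega) (by omega), hf (-1) 0 (by omega) (by omega), abs_zero, zero_add,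
        zero_add, abs_of_nonneg (by linarith [hc.2] : 0 ≤ 3 * d - 2 - c),
        abs_of_nonpos (by linarith [hc.1] : -1 - c ≤ 0)]
      have h1 := hc.1
      have h2 := hc.2
      exact abs_le.2 ⟨by omega, by omega⟩
  · simp only [hP a ha 0 m0, globePoint, abs_zero, sub_zero, zero_add]
    rw [Int.mul_ediv_cancel_left _ hd00]

/-! ### Vertex count, padding and conclusion. -/

theorem globeVertices_eq_image (d : ℤ) : globeVertices d =
    ((Finset.Icc (-1) (3 * d - 2) ×ˢ Finset.Icc (-d) d).image
      fun x => globePoint d x.1 x.2 : Finset (ℤ × ℤ)) := by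
  ext p
  simp only [globeVertices, Set.mem_ofPred_eq, Finset.coe_image, Set.mem_image, Finset.mem_coe,
    Finset.mem_product, Finset.mem_Icc, Prod.exists, Set.mem_Icc]
  constructor
  · rintro ⟨a, ha, j, hj, rfl⟩
    exact ⟨a, j, ⟨ha, hj⟩, rfl⟩
  · rintro ⟨a, j, ⟨ha, hj⟩, rfl⟩
    exact ⟨a, ha, j, hj, rfl⟩

theorem ncard_globeVertices_le (d : ℕ) : (globeVertices d).ncard ≤ 3 * d * (2 * d + 1) := by
  rw [globeVertices_eq_image, Set.ncard_coe_finset]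
  refine Finset.card_image_le.trans ?_
  rw [Finset.card_product, Int.card_Icc, Int.card_Icc]
  apply Nat.mul_le_mul <;> omega

theorem infinite_outerVertices (d : ℤ) : (outerVertices d).Infinite := by
  refine Set.infinite_of_injective_forall_mem (f := fun k : ℕ => ((-d - 1 - k, 0) : ℤ × ℤ)) ?_ ?_
  · intro k l h
    simp only [Prod.mk.injEq, and_true] at h
    omega
  · intro k
    exact ⟨by simp only; omega, rfl⟩

/-- A planar globe, with isolated vertices added, on any given large enough number of vertices. -/
theorem exists_isPlanar_isGlobe {n d : ℕ} (hd : 1 ≤ d) (hn : 9 * d ^ 2 ≤ n) :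
    ∃ (G : SimpleGraph (Fin n)) (P : ℤ → ℤ → Fin n), G.IsPlanar ∧ IsGlobe G d P := by
  have hd' : (1 : ℤ) ≤ d := by exact_mod_cast hd
  have hdn : 0 < n := by nlinarith
  have hfin : (globeVertices d).Finite := by
    rw [globeVertices_eq_image]
    exact Finset.finite_toSet _
  -- The globe has at most `3 * d * (2 * d + 1) ≤ 9 * d ^ 2` vertices; outer lattice points fill up
  -- to exactly `n`.
  obtain ⟨T, hT1, hT2, hT⟩ := ((infinite_outerVertices d).mono
    (Set.subset_union_right (s := globeVertices d))).exists_superset_ncard_eq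
    Set.subset_union_left hfin
    (k := n) ((ncard_globeVertices_le d).trans (by nlinarith))
  have : Finite T := Set.finite_of_ncard_pos (by omega)
  let ψ : T ≃ Fin n := Finite.equivFinOfCardEq hT
  let φ : Fin n → ℤ × ℤ := fun i => (ψ.symm i : ℤ × ℤ)
  have hφ : Function.Injective φ := Subtype.val_injective.comp ψ.symm.injective
  -- `P` must be total; outside the range of longitudes and latitudes its value is an arbitrary
  -- vertex.
  have hsurj : ∀ a j, ∃ x, a ∈ Set.Icc (-1) (3 * (d : ℤ) - 2) → j ∈ Set.Icc (-(d : ℤ)) d →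
      φ x = globePoint d a j := by
    intro a j
    by_cases h : a ∈ Set.Icc (-1) (3 * (d : ℤ) - 2) ∧ j ∈ Set.Icc (-(d : ℤ)) d
    · exact ⟨ψ ⟨globePoint d a j, hT1 ⟨a, h.1, j, h.2, rfl⟩⟩, fun _ _ => by simp [φ]⟩
    · exact ⟨⟨0, hdn⟩, fun h1 h2 => absurd ⟨h1, h2⟩ h⟩
  choose P hP using hsurj
  exact ⟨(globeGraph d).comap φ, P, isPlanar_comap_globeGraph hd' hφ fun x => hT2 (ψ.symm x).2,
    isGlobe_comap_globeGraph hd' hφ fun a ha j hj => hP a j ha hj⟩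

theorem exists_kprSepProb_eq_zero {n d : ℕ} (hd : 1 ≤ d) (hn : 9 * d ^ 2 ≤ n) :
    ∃ (G : SimpleGraph (Fin n)) (u v : Fin n) (root : Set (Fin n) → Fin n),
      G.IsPlanar ∧ G.dist u v = d ∧ IsRootRule root ∧
      ∀ (R : ℕ) [NeZero R], 2 * d < R → kprSepProb G R root u v = 0 := by
  obtain ⟨G, P, hplanar, hG⟩ := exists_isPlanar_isGlobe hd hn
  have hd' : (1 : ℤ) ≤ d := by exact_mod_cast hd
  exact ⟨G, P (-1) 0, P (2 * d - 1) 0, globeRoot d P, hplanar, by exact_mod_cast hG.dist_eq hd',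
    isRootRule_globeRoot hd' P, fun R _ hR => hG.kprSepProb_eq_zero hd' (by exact_mod_cast hR)⟩

theorem theorem1 :
    (∀ n d : ℕ, 1 ≤ d → (d : ℝ) ≤ Real.sqrt (n : ℝ) / 3 →
      ∃ (G : SimpleGraph (Fin n)) (u v : Fin n) (root : Set (Fin n) → Fin n),
        G.IsPlanar ∧ G.dist u v = d ∧ IsRootRule root ∧
        ∀ (R : ℕ) [NeZero R], 2 * d < R → kprSepProb G R root u v = 0) ∧
    (∀ g : ℝ → ℝ, IsKPRLowerBound g →
      ∀ d R : ℕ, 1 ≤ d → 2 * d < R → g ((d : ℝ) / (R : ℝ)) ≤ 0) := by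
  refine ⟨fun n d hd hdn => exists_kprSepProb_eq_zero hd ?_, fun g hg d R hd hR => ?_⟩
  · have h : (3 * d : ℝ) ≤ Real.sqrt n := by linarith
    have := (Real.le_sqrt (by positivity) (by positivity)).1 h
    exact_mod_cast (by linarith : (9 * d ^ 2 : ℝ) ≤ n)
  · obtain ⟨G, u, v, root, hplanar, hdist, hroot, hsep⟩ :=
      exists_kprSepProb_eq_zero hd (le_refl (9 * d ^ 2))
    have : NeZero R := ⟨by omega⟩
    -- Unreachable pairs have `dist` equal to 0, whereas here it is `d ≥ 1`.
    have hreach : G.Reachable u v := by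
      by_contra h
      rw [SimpleGraph.dist_eq_zero_of_not_reachable h] at hdist
      omega
    have := hg _ G R root u v hplanar hroot hreach
    rwa [hdist, hsep R hR, ENNReal.toReal_zero] at this
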